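/- **Diagrams.** Let $D$ be a diagram of an oriented virtual knot with $N\ge 1$ classical crossings $c_1,\dots,c_N$ and $2N$ arcs $x_1,\dots,x_{2N}$, where an arc extends from one classical crossing to the next one, ignoring virtual crossings. The *Alexander matrix* of $D$ is the $2N\times 2N$ matrix over $\mathbb Z[u,v]$ whose columns correspond to $x_1,\dots,x_{2N}$ and whose rows $2i-1$ and $2i$ are the coefficients of the following two linear forms in the arcs at $c_i$. Let $o,o'$ be the incoming and the outgoing arc of the overcrossing strand, and $w,w'$ those of the undercrossing strand. At a positive crossing the forms are $w+u\,o-o'-u\,w'$ and $v\,o'-o$; at a negative crossing they are $o+u\,w-w'-u\,o'$ and $v\,o-o'$. Let $\Delta_0(D)(u,v)$ be the determinant of this matrix, and let $\overline\Delta_0(D)$ be the polynomial with $\Delta_0(D)=(u-1)(v-1)(uv-1)\,\overline\Delta_0(D)$. A classical crossing of $D$ is *odd* if the path along the knot from the crossing back to itself goes through an odd number of classical crossings, and Kauffman's odd writhe $OW(D)$ is the sum of the signs of the odd crossings. **Virtual twist knots.** Let $n\ge 1$ and $a_1,\dots,a_n\in\mathbb Z$. The diagram $VT(a_1,\dots,a_n)$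 is that of a twist knot in which one of the two crossings of the clasp is virtual and the twist consists, from left to right, of $n$ blocks of classical half-twists, consecutive blocks being separated by one virtual crossing; the $i$th block has $|a_i|$ half-twists, which are positive crossings if $a_i>0$ and negative crossings if $a_i<0$. In detail, let $m=\sum_i|a_i|$. There are $m+1$ classical crossings: $c_1$ in the clasp, and $c_2,\dots,c_{m+1}$ in the twist from left to right. Two strands run through the twist, an odd one from left to right, with arcs $x_1,x_3,\dots,x_{2m+1}$ in this order, and an even one from right to left, with arcs $x_{2m+2},x_{2m},\dots,x_2$ in this order; the crossing $c_{i+1}$ lies between $x_{2i-1},x_{2i}$ on its left and $x_{2i+1},x_{2i+2}$ on its right. The odd strand enters the twist at the top left, and at each crossing of the twist, classical or virtual, the two strands exchange their positions (top and bottom). The overcrossing strand of a classical crossing of the twist is the one that joins the bottom left to the top right if the crossing is positive, and the one that joins the top left to the bottom right if it is negative. At $c_1$ the overcrossing strand comes in along $x_2$ and goes out along $x_1$, and the undercrossing strand comes in along $x_{2m+1}$ and goes out along $x_{2m+2}$; $c_1$ is negative if the odd strand leaves the twist at the top and positive if it leaves at the bottom. **Theorem.** For an integer $z$ let $p(z)=0$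 if $z$ is even and $p(z)=1$ if $z$ is odd. Put $s(i)=\sum_{j=1}^{i}(a_j+1)$ and $\delta=\sum_{j=1}^{n}p(a_j)\,p(s(j))$. For all $n\ge 1$ and all $a_1,\dots,a_n\in\mathbb Z$, the polynomial $\Delta_0(VT(a_1,\dots,a_n))$ is divisible by $(u-1)(v-1)(uv-1)$, and $$2\,\overline\Delta_0(VT(a_1,\dots,a_n))(-1,-1)=(-1)^{\delta+s(n)+\sum_{i=1}^{n}\lfloor |a_i|/2\rfloor}\;OW(VT(a_1,\dots,a_n)).$$ -/

import Mathlib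

namespace VirtualTwist

/-! ## Virtual link and knot diagrams, with labelled crossings and arcs -/

/-- The two passages through a classical crossing. -/
inductive Strand
  | over
  | under
  deriving DecidableEq

instance : Fintype Strand where
  elems := {.over, .under}
  complete := by rintro (_ | _) <;> simp

/-- The labels of the `2 N` arcs of a diagram with `N` classical crossings, in lexicographic order:
`(k, 0)` is the arc `x_{2k+1}` and `(k, 1)` is the arc `x_{2k+2}`. -/
abbrev Arc (N : ℕ) : Type := Fin N × Fin 2

/-- An oriented virtual link diagram with `N` classical crossings, all of whose components pass
through classical crossings, with labelled crossings and arcs. An arc extends from one classical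
crossing to the next one, ignoring virtual crossings; `arcIn c s` (`arcOut c s`) is the arc by which
the strand `s` enters (leaves) the crossing `c`. -/
structure LinkDiagram (N : ℕ) where
  sign : Fin N → ℤˣ
  arcIn : Fin N → Strand → Arc N
  arcOut : Fin N → Strand → Arc N
  arcIn_bijective : Function.Bijective fun p : Fin N × Strand => arcIn p.1 p.2
  arcOut_bijective : Function.Bijective fun p : Fin N × Strand => arcOut p.1 p.2

/-- The arc that follows a given arc: go through the classical crossing at which it ends. -/
noncomputable def LinkDiagram.next {N : ℕ} (D : LinkDiagram N) (x : Arc N) : Arc N :=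
  let p := (Equiv.ofBijective _ D.arcIn_bijective).symm x
  D.arcOut p.1 p.2

/-- A virtual knot diagram: the diagram has a single component. -/
structure KnotDiagram (N : ℕ) extends LinkDiagram N where
  connected : ∀ x y : Arc N, ∃ k : ℕ, toLinkDiagram.next^[k] x = y

/-! ## The Alexander polynomial of a diagram -/

noncomputable section

/-- The variable `u`. -/
def u : MvPolynomial (Fin 2) ℤ := MvPolynomial.X 0

/-- The variable `v`. -/
def v : MvPolynomial (Fin 2) ℤ := MvPolynomial.X 1

/-- The linear form `x` in the free module on the arcs. -/
def arcForm {N : ℕ} (x : Arc N) : Arc N → MvPolynomial (Fin 2) ℤ := Pi.single x 1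

/-- The two relations at a classical crossing.
Positive crossing: `under_in + u over_in - over_out - u under_out` and `v over_out - over_in`.
Negative crossing: `over_in + u under_in - under_out - u over_out` and `v over_in - over_out`. -/
def LinkDiagram.relation {N : ℕ} (D : LinkDiagram N) (c : Fin N) :
    Fin 2 → Arc N → MvPolynomial (Fin 2) ℤ :=
  let oi := arcForm (D.arcIn c .over)
  let oo := arcForm (D.arcOut c .over)
  let ui := arcForm (D.arcIn c .under)
  let uo := arcForm (D.arcOut c .under)
  if D.sign c = 1 then
    ![ui + u • oi - oo - u • uo, v • oo - oi]
  else
    ![oi + u • ui - uo - u • oo, v • oi - oo]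

/-- The Alexander matrix: the rows `(c, 0)`, `(c, 1)` are the two relations at the crossing `c`,
the columns are the arcs. Rows and columns are both ordered lexicographically. -/
def LinkDiagram.alexanderMatrix {N : ℕ} (D : LinkDiagram N) :
    Matrix (Fin N × Fin 2) (Arc N) (MvPolynomial (Fin 2) ℤ) :=
  Matrix.of fun r x => D.relation r.1 r.2 x

/-- `Δ₀` of a labelled diagram, as a polynomial in `u`, `v`. -/
def LinkDiagram.alexander {N : ℕ} (D : LinkDiagram N) : MvPolynomial (Fin 2) ℤ :=
  D.alexanderMatrix.det

/-- `q` is the reduced polynomial of the diagram: `Δ₀ = (u - 1) (v - 1) (u v - 1) q`.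
There is at most one such `q`, as polynomials over `ℤ` form a domain. -/
def LinkDiagram.IsReducedAlexander {N : ℕ} (D : LinkDiagram N)
    (q : MvPolynomial (Fin 2) ℤ) : Prop :=
  D.alexander = (u - 1) * (v - 1) * (u * v - 1) * q

end

/-! ## The odd writhe -/

/-- A classical crossing is odd if the path that leaves it along the overcrossing strand goes
through an odd number of classical crossings before it comes back to it. -/
def KnotDiagram.IsOdd {N : ℕ} (D : KnotDiagram N) (c : Fin N) : Prop :=
  ∃ k : ℕ, Odd k ∧ D.next^[k] (D.arcOut c .over) = D.arcIn c .under ∧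
    ∀ j < k, D.next^[j] (D.arcOut c .over) ≠ D.arcIn c .under

open Classical in
/-- The sum of the signs of the odd crossings. -/
noncomputable def KnotDiagram.oddWrithe {N : ℕ} (D : KnotDiagram N) : ℤ :=
  ∑ c : Fin N, if D.IsOdd c then (D.sign c : ℤ) else 0

/-! ## The virtual twist knot diagrams -/

/-- A crossing in the twist: a classical half-twist of the given sign, or a virtual crossing. -/
inductive TwistCrossing
  | real (ε : ℤˣ)
  | virt

/-- A block of half-twists. -/
def block (k : ℤ) : List TwistCrossing :=
  List.replicate k.natAbs (.real (if 0 < k then 1 else -1))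

/-- All crossings of the twist from left to right: the blocks, with a single virtual crossing
between consecutive blocks. -/
def twist {n : ℕ} (a : Fin n → ℤ) : List TwistCrossing :=
  List.intercalate [.virt] ((List.ofFn a).map block)

/-- The classical crossings in a piece of the twist, from left to right. Each is recorded with its
sign and with the position of the strand that is oriented from left to right (the odd strand):
`true` if it comes in from the top left (and leaves at the bottom right), `false` if it comes in from
the bottom left. The position changes at each crossing, real or virtual. The first argument is the
position at the left end of the piece. -/
def realCrossings : Bool → List TwistCrossing → List (ℤˣ × Bool)
  | _, [] => []
  | top, .virt :: w => realCrossings (!top) w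
  | top, .real ε :: w => (ε, top) :: realCrossings (!top) w

/-- The position of the odd strand at the right end of a piece of the twist. -/
def exitPosition : Bool → List TwistCrossing → Bool
  | top, [] => top
  | top, _ :: w => exitPosition (!top) w

/-- The two strands of the twist run in opposite directions. So a half-twist is positive when the
strand that joins the bottom left to the top right is the overcrossing one, and negative when the
strand that joins the top left to the bottom right is. This decides whether the odd strand is the
overcrossing one. -/
def oddOver (c : ℤˣ × Bool) : Bool := if c.1 = 1 then !c.2 else c.2

section diagram

/-- The signs. Crossing `0` is the classical crossing of the clasp, crossing `i + 1` is the `i`-th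
classical crossing of the twist. At the clasp the overcrossing strand does not depend on the twist,
while the other one is reversed when the odd strand leaves the twist at the top. -/
def vtSign (L : List (ℤˣ × Bool)) (exitTop : Bool) : Fin (L.length + 1) → ℤˣ :=
  Fin.cons (if exitTop then -1 else 1) fun i => (L.get i).1

/-- To the left of the `i`-th classical crossing of the twist are the arcs `(i, 0)`, on the odd
strand, and `(i, 1)`, on the even strand, which is oriented from right to left; to its right are the
arcs `(i + 1, 0)` and `(i + 1, 1)`. At the clasp the strand that leaves the twist at its left end
passes over and the strand that leaves the twist at its right end passes under. -/
def vtIn (L : List (ℤˣ × Bool)) : Fin (L.length + 1) → Strand → Arc (L.length + 1) :=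
  Fin.cons
    (fun s => match s with
      | .over => (0, 1)
      | .under => (Fin.last _, 0))
    fun i s =>
      if (s = .over ↔ oddOver (L.get i) = true) then (i.castSucc, 0) else (i.succ, 1)

/-- The arcs that leave the crossings; see `vtIn`. -/
def vtOut (L : List (ℤˣ × Bool)) : Fin (L.length + 1) → Strand → Arc (L.length + 1) :=
  Fin.cons
    (fun s => match s with
      | .over => (0, 0)
      | .under => (Fin.last _, 1))
    fun i s =>
      if (s = .over ↔ oddOver (L.get i) = true) then (i.succ, 0) else (i.castSucc, 1)

theorem vtIn_bijective (L : List (ℤˣ × Bool)) :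
    Function.Bijective fun p : Fin (L.length + 1) × Strand => vtIn L p.1 p.2 := by
  rw [Fintype.bijective_iff_injective_and_card]
  refine ⟨?_, by simp [Fintype.card_prod]; rfl⟩
  rintro ⟨c, s⟩ ⟨d, t⟩ h
  cases c using Fin.cases <;> cases d using Fin.cases <;> cases s <;> cases t <;>
    simp [vtIn] at h ⊢ <;>
    grind [Fin.ext_iff, Fin.val_castSucc]

theorem vtOut_bijective (L : List (ℤˣ × Bool)) :
    Function.Bijective fun p : Fin (L.length + 1) × Strand => vtOut L p.1 p.2 := by
  rw [Fintype.bijective_iff_injective_and_card]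
  refine ⟨?_, by simp [Fintype.card_prod]; rfl⟩
  rintro ⟨c, s⟩ ⟨d, t⟩ h
  cases c using Fin.cases <;> cases d using Fin.cases <;> cases s <;> cases t <;>
    simp [vtOut] at h ⊢ <;>
    grind [Fin.ext_iff, Fin.val_castSucc]

/-- The underlying link diagram of a virtual twist knot diagram. -/
def vtLink (L : List (ℤˣ × Bool)) (exitTop : Bool) : LinkDiagram (L.length + 1) where
  sign := vtSign L exitTop
  arcIn := vtIn L
  arcOut := vtOut L
  arcIn_bijective := vtIn_bijective L
  arcOut_bijective := vtOut_bijective L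

theorem LinkDiagram.next_arcIn {N : ℕ} (D : LinkDiagram N) (c : Fin N) (s : Strand) :
    D.next (D.arcIn c s) = D.arcOut c s := by
  have h : (Equiv.ofBijective _ D.arcIn_bijective).symm (D.arcIn c s) = (c, s) := by
    rw [Equiv.symm_apply_eq]; rfl
  simp only [LinkDiagram.next, h]

theorem vtLink_connected (L : List (ℤˣ × Bool)) (e : Bool) (x y : Arc (L.length + 1)) :
    ∃ k : ℕ, (vtLink L e).next^[k] x = y := by
  have tr : ∀ {x y z : Arc (L.length + 1)}, (∃ k : ℕ, (vtLink L e).next^[k] x = y) →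
      (∃ k : ℕ, (vtLink L e).next^[k] y = z) → ∃ k : ℕ, (vtLink L e).next^[k] x = z := by
    rintro x y z ⟨k, rfl⟩ ⟨l, rfl⟩
    exact ⟨l + k, by rw [Function.iterate_add_apply]⟩
  have one : ∀ {x y : Arc (L.length + 1)}, (vtLink L e).next x = y →
      ∃ k : ℕ, (vtLink L e).next^[k] x = y := fun h => ⟨1, h⟩
  have hA : (vtLink L e).next (0, 1) = (0, 0) := (vtLink L e).next_arcIn 0 .over
  have hB : (vtLink L e).next (Fin.last _, 0) = (Fin.last _, 1) :=
    (vtLink L e).next_arcIn 0 .under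
  have hin : ∀ (i : Fin L.length) (s : Strand), (vtLink L e).arcIn i.succ s =
      if (s = .over ↔ oddOver (L.get i) = true) then (i.castSucc, 0) else (i.succ, 1) :=
    fun _ _ => rfl
  have hout : ∀ (i : Fin L.length) (s : Strand), (vtLink L e).arcOut i.succ s =
      if (s = .over ↔ oddOver (L.get i) = true) then (i.succ, 0) else (i.castSucc, 1) :=
    fun _ _ => rfl
  have hodd : ∀ i : Fin L.length, (vtLink L e).next (i.castSucc, 0) = (i.succ, 0) := by
    intro i
    by_cases h : oddOver (L.get i) = true
    · have := (vtLink L e).next_arcIn i.succ .over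
      rw [hin, hout] at this
      simpa [-List.get_eq_getElem, h] using this
    · have := (vtLink L e).next_arcIn i.succ .under
      rw [hin, hout] at this
      simpa [-List.get_eq_getElem, h] using this
  have heven : ∀ i : Fin L.length, (vtLink L e).next (i.succ, 1) = (i.castSucc, 1) := by
    intro i
    by_cases h : oddOver (L.get i) = true
    · have := (vtLink L e).next_arcIn i.succ .under
      rw [hin, hout] at this
      simpa [-List.get_eq_getElem, h] using this
    · have := (vtLink L e).next_arcIn i.succ .over
      rw [hin, hout] at this
      simpa [-List.get_eq_getElem, h] using this
  have f0 : ∀ i, ∃ k : ℕ, (vtLink L e).next^[k] (0, 0) = (i, 0) := by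
    intro i
    induction i using Fin.induction with
    | zero => exact ⟨0, rfl⟩
    | succ i ih => exact tr ih (one (hodd i))
  have f1 : ∀ i, ∃ k : ℕ, (vtLink L e).next^[k] (i, 0) = (Fin.last _, 0) := by
    intro i
    induction i using Fin.reverseInduction with
    | last => exact ⟨0, rfl⟩
    | cast i ih => exact tr (one (hodd i)) ih
  have g0 : ∀ i, ∃ k : ℕ, (vtLink L e).next^[k] (i, 1) = (0, 1) := by
    intro i
    induction i using Fin.induction with
    | zero => exact ⟨0, rfl⟩
    | succ i ih => exact tr (one (heven i)) ih
  have g1 : ∀ i, ∃ k : ℕ, (vtLink L e).next^[k] (Fin.last _, 1) = (i, 1) := by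
    intro i
    induction i using Fin.reverseInduction with
    | last => exact ⟨0, rfl⟩
    | cast i ih => exact tr ih (one (heven i))
  have toZero : ∀ z : Arc (L.length + 1), ∃ k : ℕ, (vtLink L e).next^[k] z = (0, 0) := by
    rintro ⟨i, j⟩
    fin_cases j
    · exact tr (f1 i) (tr (one hB) (tr (g0 _) (one hA)))
    · exact tr (g0 i) (one hA)
  have fromZero : ∀ z : Arc (L.length + 1), ∃ k : ℕ, (vtLink L e).next^[k] (0, 0) = z := by
    rintro ⟨i, j⟩
    fin_cases j
    · exact f0 i
    · exact tr (f0 _) (tr (one hB) (g1 i))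
  exact tr (toZero x) (fromZero y)

end diagram

/-- The number of classical crossings of the virtual twist knot diagram `VT(a_1, …, a_n)`: those of
the twist and the one of the clasp. -/
def vtCrossings {n : ℕ} (a : Fin n → ℤ) : ℕ := (realCrossings true (twist a)).length + 1

/-- The labelled diagram `VT(a_1, …, a_n)`. At the left end of the twist the odd strand enters at
the top. -/
def VT {n : ℕ} (a : Fin n → ℤ) : KnotDiagram (vtCrossings a) where
  toLinkDiagram := vtLink (realCrossings true (twist a)) (exitPosition true (twist a))
  connected := vtLink_connected _ _

/-! ## The exponent -/

/-- The parity of an integer, as `0` or `1`. -/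
def p (z : ℤ) : ℤ := if Even z then 0 else 1

/-- `s(i) = ∑_{j ≤ i} (a_j + 1)`; here `a_j` is `a (j - 1)`. -/
def s {n : ℕ} (a : Fin n → ℤ) (i : ℕ) : ℤ :=
  ∑ j : Fin n, if (j : ℕ) < i then a j + 1 else 0

/-- `δ = ∑_j p(a_j) p(s(j))`. -/
def δ {n : ℕ} (a : Fin n → ℤ) : ℤ := ∑ j : Fin n, p (a j) * p (s a (j + 1))

end VirtualTwist

/-! Group the arcs in the pairs $(x_{2i+1},x_{2i+2})$. A crossing of the twist relates two
consecutive pairs and the clasp relates the last pair to the first, so the Alexander matrix is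
cyclic block bidiagonal with $2\times2$ blocks. Once $u,v$ are inverted, the twist relations express
every pair through the first one by a matrix `transfer`, and $\Delta_0$ becomes a $2\times2$
determinant at the clasp times the product of the determinants of the right blocks
(`alexanderMatrix_map_det`).

In the coordinates $x-y,\ y$ of a pair, every crossing is triangular: its diagonal is $u^{\mp1},
v^{\pm1}$ according to the position of the odd strand, and the mixing term is a multiple of $uv-1$.
Hence `transfer` depends only on the drift $d$ (tops minus bottoms) and on one entry `shear`. The
clasp determinant is an explicit function of $d$ plus or minus $(u-1)(v-1)(uv-1)$ times `shear`, and
both parts are divisible as required (`exists_clasp_quotient`). At $(-1,-1)$ the two contributions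
combine, crossing by crossing, into the sum of the signs in the twist
(`two_mul_shearCount_sub_drift`), with a correction for the clasp when the twist has an odd number
of classical crossings. By a two-colouring of the arcs, this is the odd writhe (`oddWrithe_eq`).

The sign that remains is given by the number of classical crossings which the odd strand enters at
the bottom and by its exit position. Counting block by block turns these into
$\delta+\sum\lfloor|a_i|/2\rfloor$ and $s(n)$. Divisibility descends from the localization because
neither $u$ nor $v$ divides $(u-1)(v-1)(uv-1)$. -/

namespace VirtualTwist

/-! ### Determinants of cyclic block bidiagonal matrices -/

section Determinant

variable {R : Type*} [CommRing R]

/-- If every block row but the first annihilates the block column `T`, the first block column can be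
replaced by `C + E * T (last)` on the diagonal. -/
theorem det_eq_det_mul_prod_det_of_cyclic {m : ℕ} (A B : Fin m → Matrix (Fin 2) (Fin 2) R)
    (C E : Matrix (Fin 2) (Fin 2) R) (T : Fin (m + 1) → Matrix (Fin 2) (Fin 2) R) (hT : T 0 = 1)
    (h : ∀ i : Fin m, A i * T i.castSucc + B i * T i.succ = 0)
    (M : Matrix (Fin (m + 1) × Fin 2) (Fin (m + 1) × Fin 2) R)
    (hM0 : ∀ a k b, M (0, a) (k, b) =
      (if k = 0 then C a b else 0) + (if k = Fin.last m then E a b else 0))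
    (hM : ∀ (i : Fin m) a k b, M (i.succ, a) (k, b) =
      (if k = i.castSucc then A i a b else 0) + (if k = i.succ then B i a b else 0)) :
    M.det = (C + E * T (Fin.last m)).det * ∏ i, (B i).det := by
  classical
  -- The identity with its first block column replaced by `T`; since `T 0 = 1` it is unipotent, and
  -- `M * U` has zeros below the top of its first block column.
  let U : Matrix (Fin (m + 1) × Fin 2) (Fin (m + 1) × Fin 2) R :=
    Matrix.of fun x y => if y.1 = 0 then T x.1 x.2 y.2 else if x = y then 1 else 0
  have blocks : ∀ (N : Matrix (Fin (m + 1) × Fin 2) (Fin (m + 1) × Fin 2) R)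
      (e : Equiv.Perm (Fin (m + 1))), N.BlockTriangular (fun x => e x.1) →
      N.det = ∏ k, (Matrix.of fun a b => N (k, a) (k, b)).det := by
    intro N e hN
    rw [hN.det_fintype, ← Equiv.prod_comp e]
    refine Finset.prod_congr rfl fun k _ => ?_
    let g : Fin 2 ≃ {x : Fin (m + 1) × Fin 2 // e x.1 = e k} :=
      { toFun := fun a => ⟨(k, a), rfl⟩
        invFun := fun x => x.1.2
        left_inv := fun a => rfl
        right_inv := by
          rintro ⟨⟨x, a⟩, hx⟩
          have : x = k := e.injective hx
          subst this
          rfl }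
    rw [← Matrix.det_submatrix_equiv_self g]
    rfl
  have hU : U.det = 1 := by
    rw [← Matrix.det_transpose, blocks U.transpose (Equiv.refl _)]
    · refine Finset.prod_eq_one fun k _ => ?_
      by_cases hk : k = 0
      · subst hk
        simp [U, hT, Matrix.det_fin_two]
      · simp [U, hk, Matrix.det_fin_two]
    · rintro ⟨x, a⟩ ⟨y, b⟩ hxy
      have hxy : y < x := hxy
      have hx : x ≠ 0 := (lt_of_le_of_lt (Fin.zero_le y) hxy).ne'
      simp [U, hx, hxy.ne]
  have hcol : ∀ x b, (M * U) x (0, b) = ∑ k, ∑ c, M x (k, c) * T k c b := by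
    intro x b
    simp [Matrix.mul_apply, U, Fintype.sum_prod_type]
  have hcol' : ∀ x k b, k ≠ 0 → (M * U) x (k, b) = M x (k, b) := by
    intro x k b hk
    simp [Matrix.mul_apply, U, hk]
  have h00 : ∀ a b, (M * U) (0, a) (0, b) = (C + E * T (Fin.last m)) a b := by
    intro a b
    rw [hcol]
    simp [hM0, add_mul, Finset.sum_add_distrib, ite_mul, hT, Matrix.mul_apply, -Fin.sum_univ_two,
      Matrix.one_apply]
  have hi0 : ∀ (i : Fin m) a b, (M * U) (i.succ, a) (0, b) = 0 := by
    intro i a b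
    rw [hcol, Finset.sum_comm]
    have := congrFun (congrFun (h i) a) b
    rw [Matrix.add_apply, Matrix.mul_apply, Matrix.mul_apply, ← Finset.sum_add_distrib] at this
    refine Eq.trans ?_ this
    refine Finset.sum_congr rfl fun c _ => ?_
    simp [hM, add_mul, Finset.sum_add_distrib]
  -- Negation on `Fin (m + 1)` orders the indices as $0, m, m-1, \dots, 1$. In this order both the
  -- subdiagonal blocks `A i` and the corner block `E` lie above the diagonal.
  rw [← mul_one M.det, ← hU, ← Matrix.det_mul, blocks (M * U) (Equiv.neg _)]
  · rw [Fin.prod_univ_succ]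
    congr 1
    · congr 1
      ext a b
      exact h00 a b
    · refine Finset.prod_congr rfl fun i _ => ?_
      congr 1
      ext a b
      simp only [Matrix.of_apply]
      rw [hcol' _ _ _ (Fin.succ_ne_zero i), hM]
      simp [(Fin.castSucc_lt_succ (i := i)).ne']
  · rintro ⟨x, a⟩ ⟨y, b⟩ hxy
    have hxy : -y < -x := hxy
    cases x using Fin.cases with
    | zero => simp at hxy
    | succ i =>
      by_cases hy : y = 0
      · subst hy
        exact hi0 i a b
      · rw [hcol' _ _ _ hy, hM]
        obtain ⟨j, rfl⟩ := Fin.exists_succ_eq.2 hy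
        have hij : i < j := by
          rw [Fin.lt_def, Fin.val_neg', Fin.val_neg'] at hxy
          rw [Nat.mod_eq_of_lt, Nat.mod_eq_of_lt] at hxy <;> simp at hxy ⊢
          omega
        have h1 : j.succ ≠ i.castSucc := by
          simp only [ne_eq, Fin.ext_iff, Fin.val_succ, Fin.val_castSucc]
          omega
        have h2 : j.succ ≠ i.succ := by
          simpa using hij.ne'
        simp only [h1, h2, if_false, add_zero]

end Determinant

/-! ### Transfer matrices along the twist -/

section Transfer

variable {R : Type*} [CommRing R]

/-- The coefficients, at a crossing of the twist, of the two arcs on its left. -/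
def leftBlock (u v : R) (c : ℤˣ × Bool) : Matrix (Fin 2) (Fin 2) R :=
  if c.1 = 1 then (if c.2 then !![1, -1; 0, v] else !![u, -u; -1, 0])
  else (if c.2 then !![1, -1; v, 0] else !![u, -u; 0, -1])

/-- The coefficients, at a crossing of the twist, of the two arcs on its right. -/
def rightBlock (u v : R) (c : ℤˣ × Bool) : Matrix (Fin 2) (Fin 2) R :=
  if c.1 = 1 then (if c.2 then !![-u, u; 0, -1] else !![-1, 1; v, 0])
  else (if c.2 then !![-u, u; -1, 0] else !![-1, 1; 0, v])

/-- The coefficients, at the clasp, of the two arcs at the left end of the twist. -/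
def claspLeftBlock (u v : R) (exitTop : Bool) : Matrix (Fin 2) (Fin 2) R :=
  if exitTop then !![-u, 1; -1, v] else !![-1, u; v, -1]

/-- The coefficients, at the clasp, of the two arcs at the right end of the twist. -/
def claspRightBlock (u : R) (exitTop : Bool) : Matrix (Fin 2) (Fin 2) R :=
  if exitTop then !![u, -1; 0, 0] else !![1, -u; 0, 0]

/-- The number of crossings at which the odd strand comes in at the top, minus the number of those
at which it comes in at the bottom. -/
def drift (L : List (ℤˣ × Bool)) : ℤ := (L.map fun c => if c.2 then (1 : ℤ) else -1).sum

/-- The number of negative crossings at which the odd strand comes in at the top, minus the number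
of positive ones at which it comes in at the bottom. -/
def shearCount (L : List (ℤˣ × Bool)) : ℤ :=
  (L.map fun c => if c.2 then (if c.1 = 1 then (0 : ℤ) else 1) else if c.1 = 1 then -1 else 0).sum

/-- The sum of the signs of the crossings. -/
def signSum (L : List (ℤˣ × Bool)) : ℤ := (L.map fun c => (c.1 : ℤ)).sum

/-- The number of crossings at which the odd strand comes in at the bottom. -/
def bottomCount (L : List (ℤˣ × Bool)) : ℕ := L.countP fun c => !c.2

/-- The entry of `transfer` that mixes the two coordinates `x₁ - x₂` and `x₂`,
divided by `u v - 1`. -/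
def shear (u v : Rˣ) (L : List (ℤˣ × Bool)) : R :=
  (L.foldl (fun q c =>
    (if c.2 then
      (q.1 + 1, if c.1 = 1 then v * q.2 else v * q.2 + (u⁻¹ * u ^ (-q.1) : Rˣ))
    else
      (q.1 - 1, if c.1 = 1 then (v⁻¹ : Rˣ) * (q.2 - (u ^ (-q.1) : Rˣ)) else (v⁻¹ : Rˣ) * q.2)))
    ((0 : ℤ), (0 : R))).2

/-- The matrix that expresses the two arcs at the right end of a piece of the twist in terms of
those at its left end. -/
def transfer (u v : Rˣ) (L : List (ℤˣ × Bool)) : Matrix (Fin 2) (Fin 2) R :=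
  let α : R := (u ^ (-drift L) : Rˣ)
  let β : R := (v ^ drift L : Rˣ)
  let c : R := (u * v - 1) * shear u v L
  !![α + c, β - α - c; c, β - c]

@[simp] theorem drift_nil : drift [] = 0 := rfl

theorem drift_concat (L : List (ℤˣ × Bool)) (c : ℤˣ × Bool) :
    drift (L ++ [c]) = drift L + if c.2 then 1 else -1 := by
  simp [drift]

@[simp] theorem shear_nil (u v : Rˣ) : shear u v [] = 0 := rfl

theorem shear_concat (u v : Rˣ) (L : List (ℤˣ × Bool)) (c : ℤˣ × Bool) :
    shear u v (L ++ [c]) = if c.2 then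
      (if c.1 = 1 then v * shear u v L else v * shear u v L + (u⁻¹ * u ^ (-drift L) : Rˣ))
    else
      (if c.1 = 1 then (v⁻¹ : Rˣ) * (shear u v L - (u ^ (-drift L) : Rˣ))
      else (v⁻¹ : Rˣ) * shear u v L) := by
  -- The first component of the fold is the running drift.
  have key : ∀ L : List (ℤˣ × Bool), (L.foldl (fun q c =>
    (if c.2 then
      (q.1 + 1, if c.1 = 1 then v * q.2 else v * q.2 + (u⁻¹ * u ^ (-q.1) : Rˣ))
    else
      (q.1 - 1, if c.1 = 1 then (v⁻¹ : Rˣ) * (q.2 - (u ^ (-q.1) : Rˣ)) else (v⁻¹ : Rˣ) * q.2)))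
    ((0 : ℤ), (0 : R))).1 = drift L := by
    intro L
    induction L using List.reverseRecOn with
    | nil => rfl
    | append_singleton L c ih =>
      rw [List.foldl_append, drift_concat, ← ih]
      by_cases h : c.2 <;> simp [h, sub_eq_add_neg]
  rw [← key L]
  simp only [shear, List.foldl_append, List.foldl_cons, List.foldl_nil]
  by_cases h : c.2 <;> simp only [h, if_true, if_false, Bool.false_eq_true]

theorem transfer_nil (u v : Rˣ) : transfer u v [] = 1 := by
  ext i j
  fin_cases i <;> fin_cases j <;> simp [transfer]

/-- This is the recursion $T_{i+1}=-B_i^{-1}A_iT_i$ without the inverse. The vector $(1,1)$ is an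
eigenvector of every step, which is why `transfer` has constant row sums $\beta$. -/
theorem leftBlock_mul_transfer (u v : Rˣ) (L : List (ℤˣ × Bool)) (c : ℤˣ × Bool) :
    leftBlock (u : R) v c * transfer u v L + rightBlock (u : R) v c * transfer u v (L ++ [c]) = 0 := by
  have hu : (u : R) * (u⁻¹ : Rˣ) = 1 := u.mul_inv
  have hv : (v : R) * (v⁻¹ : Rˣ) = 1 := v.mul_inv
  obtain ⟨ε, b⟩ := c
  cases b <;> by_cases hε : ε = 1 <;>
  · simp only [transfer, drift_concat, shear_concat, leftBlock, rightBlock, hε, if_true, if_false,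
      Bool.false_eq_true, neg_add, zpow_add, zpow_neg, zpow_one, neg_neg, Units.val_mul]
    -- The powers and the shear enter as free variables: the identity only needs $uu^{-1}=1$ and
    -- $vv^{-1}=1$.
    generalize ((u ^ drift L)⁻¹ : Rˣ) = α
    generalize ((v ^ drift L) : Rˣ) = β
    generalize shear u v L = c
    generalize (α : R) = α
    generalize (β : R) = β
    generalize ((u⁻¹ : Rˣ) : R) = u' at *
    generalize ((v⁻¹ : Rˣ) : R) = v' at *
    generalize (u : R) = u at *
    generalize (v : R) = v at *
    ext i j
    fin_cases i <;> fin_cases j <;> simp <;> grind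

theorem det_rightBlock (u v : R) (c : ℤˣ × Bool) :
    (rightBlock u v c).det = if c.2 then u else -v := by
  obtain ⟨ε, b⟩ := c
  cases b <;> by_cases hε : ε = 1 <;> simp [rightBlock, hε, Matrix.det_fin_two]

theorem alexanderMatrix_map_det (u v : Rˣ) (g : MvPolynomial (Fin 2) ℤ →+* R)
    (hu : g VirtualTwist.u = u) (hv : g VirtualTwist.v = v) (L : List (ℤˣ × Bool)) (e : Bool) :
    g (vtLink L e).alexander =
      (claspLeftBlock (u : R) v e + claspRightBlock (u : R) e * transfer u v L).det *
        (L.map fun c => if c.2 then (u : R) else -v).prod := by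
  rw [LinkDiagram.alexander, RingHom.map_det,
    det_eq_det_mul_prod_det_of_cyclic (m := L.length)
      (fun i => leftBlock (u : R) v (L.get i)) (fun i => rightBlock (u : R) v (L.get i))
      (claspLeftBlock (u : R) v e) (claspRightBlock (u : R) e)
      (fun i => transfer u v (L.take i))]
  · congr 1
    · simp
    · simp only [det_rightBlock]
      rw [← List.prod_ofFn]
      congr 1
      refine List.ext_getElem (by simp) ?_
      simp
  · simp [transfer_nil]
  · intro i
    have : L.take (i.succ : Fin (L.length + 1)) = L.take i ++ [L.get i] := by
      simp
    rw [this]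
    exact leftBlock_mul_transfer u v _ _
  · intro a k b
    have h0 : (vtLink L e).sign 0 = if e then -1 else 1 := rfl
    have h1 : (vtLink L e).arcIn 0 .over = (0, 1) := rfl
    have h2 : (vtLink L e).arcIn 0 .under = (Fin.last _, 0) := rfl
    have h3 : (vtLink L e).arcOut 0 .over = (0, 0) := rfl
    have h4 : (vtLink L e).arcOut 0 .under = (Fin.last _, 1) := rfl
    simp only [RingHom.mapMatrix_apply, Matrix.map_apply, LinkDiagram.alexanderMatrix,
      Matrix.of_apply, LinkDiagram.relation, h0, h1, h2, h3, h4]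
    cases e <;> fin_cases a <;> fin_cases b <;>
      simp [arcForm, Pi.single_apply, claspLeftBlock, claspRightBlock, hu, hv, apply_ite g] <;>
      split_ifs <;> simp_all
  · intro i a k b
    have h0 : (vtLink L e).sign i.succ = (L.get i).1 := rfl
    have hin : ∀ s : Strand, (vtLink L e).arcIn i.succ s =
      if (s = .over ↔ oddOver (L.get i) = true) then (i.castSucc, 0) else (i.succ, 1) :=
      fun _ => rfl
    have hout : ∀ s : Strand, (vtLink L e).arcOut i.succ s =
      if (s = .over ↔ oddOver (L.get i) = true) then (i.succ, 0) else (i.castSucc, 1) :=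
      fun _ => rfl
    simp only [RingHom.mapMatrix_apply, Matrix.map_apply, LinkDiagram.alexanderMatrix,
      Matrix.of_apply, LinkDiagram.relation, h0, hin, hout]
    generalize L.get i = c
    obtain ⟨ε, top⟩ := c
    cases top <;> by_cases hε : ε = 1 <;> fin_cases a <;> fin_cases b <;>
      simp [arcForm, Pi.single_apply, leftBlock, rightBlock, hu, hv, apply_ite g, hε, oddOver] <;>
      split_ifs <;> simp_all <;> ring

end Transfer

/-! ### Division by $(u-1)(v-1)(uv-1)$ and values at $(-1,-1)$ -/

section Quotient

variable {R : Type*} [CommRing R]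

theorem map_unit_zpow {S : Type*} [CommRing S] (φ : R →+* S) (w : Rˣ) (hw : φ w = -1) (t : ℤ) :
    φ (w ^ t : Rˣ) = (t.negOnePow : ℤ) := by
  have h : Units.map (φ : R →* S) w = -1 := by
    ext
    simpa using hw
  have : φ (w ^ t : Rˣ) = (Units.map (φ : R →* S) (w ^ t) : Sˣ) := rfl
  rw [this, map_zpow, h]
  rcases Int.even_or_odd t with ht | ht
  · simp [ht.neg_one_zpow, Int.negOnePow_even t ht]
  · simp [ht.neg_one_zpow, Int.negOnePow_odd t ht]

theorem exists_geometric_quotient (w : Rˣ) (φ : R →+* ℤ) (hw : φ w = 1) (t : ℤ) :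
    ∃ q : R, (w - 1) * q = (w ^ t : Rˣ) - 1 ∧ φ q = t := by
  have hpow : ∀ t : ℤ, φ (w ^ t : Rˣ) = 1 := by
    intro t
    have h : Units.map (φ : R →* ℤ) w = 1 := by
      ext
      simpa using hw
    have : φ (w ^ t : Rˣ) = (Units.map (φ : R →* ℤ) (w ^ t) : ℤˣ) := rfl
    rw [this, map_zpow, h, one_zpow, Units.val_one]
  induction t using Int.induction_on with
  | zero => exact ⟨0, by simp⟩
  | succ i ih =>
    obtain ⟨q, h1, h2⟩ := ih
    refine ⟨q + (w ^ (i : ℤ) : Rˣ), ?_, ?_⟩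
    · rw [mul_add, h1, zpow_add, zpow_one, Units.val_mul]
      ring
    · rw [map_add, h2, hpow]
  | pred i ih =>
    obtain ⟨q, h1, h2⟩ := ih
    refine ⟨q - (w ^ (-(i : ℤ) - 1) : Rˣ), ?_, ?_⟩
    · have : ((w ^ (-(i : ℤ)) : Rˣ) : R) = (w ^ (-(i : ℤ) - 1) : Rˣ) * w := by
        rw [← Units.val_mul, ← zpow_add_one, sub_add_cancel]
      rw [mul_sub, h1, this]
      ring
    · rw [map_sub, h2, hpow]

/-- Let $F(t)$ be the right-hand side. Then $F(0)=0$ and $F(t+1)-F(t)=(u-1)(v-1)(v^t-u^{-t})$, where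
$v^t-u^{-t}=u^{-t}((uv)^t-1)$ is divisible by $uv-1$ with a quotient of value $(-1)^t t$. For $t\ge
0$ the value of `q` is therefore the alternating sum $\sum_{j<t}(-1)^j j$; negative $t$ are reached
by the same differences. -/
theorem exists_drift_quotient (u v : Rˣ) (φ : R →+* ℤ) (hu : φ u = -1) (hv : φ v = -1) (t : ℤ) :
    ∃ q : R, ((u : R) - 1) * (v - 1) * (u * v - 1) * q =
        (v - 1) * (u * ((u ^ (-t) : Rˣ) - 1)) + (u - 1) * ((v ^ t : Rˣ) - 1) ∧
      2 * φ q = if Even t then -t else t - 1 := by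
  have hg : ∀ t : ℤ, ∃ g : R, ((u : R) * v - 1) * g = (v ^ t : Rˣ) - (u ^ (-t) : Rˣ) ∧
      φ g = t.negOnePow * t := by
    intro t
    obtain ⟨g, h1, h2⟩ := exists_geometric_quotient (u * v) φ (by simp [hu, hv]) t
    refine ⟨(u ^ (-t) : Rˣ) * g, ?_, ?_⟩
    · rw [Units.val_mul] at h1
      rw [mul_left_comm, h1, mul_sub, mul_one, ← Units.val_mul, mul_zpow, zpow_neg,
        inv_mul_cancel_left]
    · rw [map_mul, h2, map_unit_zpow φ u hu, Int.negOnePow_neg]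
      rfl
  induction t using Int.induction_on with
  | zero => exact ⟨0, by simp⟩
  | succ i ih =>
    obtain ⟨q, h1, h2⟩ := ih
    obtain ⟨g, h3, h4⟩ := hg i
    refine ⟨q + g, ?_, ?_⟩
    · have hui : ((u ^ (-(i : ℤ)) : Rˣ) : R) = u * (u ^ (-((i : ℤ) + 1)) : Rˣ) := by
        rw [← Units.val_mul, ← zpow_one_add]
        congr 2
        ring
      have hvi : ((v ^ ((i : ℤ) + 1) : Rˣ) : R) = (v ^ (i : ℤ) : Rˣ) * v := by
        rw [← Units.val_mul, ← zpow_add_one]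
      rw [hvi]
      linear_combination h1 + (u - 1) * (v - 1) * h3 + (v - 1) * hui
    · rw [map_add, mul_add, h2, h4]
      rcases Int.even_or_odd (i : ℤ) with h | h
      · have h' : ¬ Even ((i : ℤ) + 1) := by simpa [Int.even_add_one] using h
        rw [if_pos h, if_neg h', Int.negOnePow_even _ h, Units.val_one]
        ring
      · have h' : Even ((i : ℤ) + 1) := h.add_one
        rw [if_neg (Int.not_even_iff_odd.2 h), if_pos h', Int.negOnePow_odd _ h]
        push_cast
        ring
  | pred i ih =>
    obtain ⟨q, h1, h2⟩ := ih
    obtain ⟨g, h3, h4⟩ := hg (-(i : ℤ) - 1)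
    refine ⟨q - g, ?_, ?_⟩
    · have hui : ((u ^ (-(-(i : ℤ) - 1)) : Rˣ) : R) = u * (u ^ (-(-(i : ℤ))) : Rˣ) := by
        rw [← Units.val_mul, ← zpow_one_add]
        congr 2
        ring
      have hvi : ((v ^ (-(i : ℤ)) : Rˣ) : R) = (v ^ (-(i : ℤ) - 1) : Rˣ) * v := by
        rw [← Units.val_mul, ← zpow_add_one, sub_add_cancel]
      rw [hvi] at h1
      linear_combination h1 - (u - 1) * (v - 1) * h3 - (v - 1) * hui
    · rw [map_sub, mul_sub, h2, h4]
      rcases Int.even_or_odd (-(i : ℤ)) with h | h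
      · have h' : Odd (-(i : ℤ) - 1) := h.sub_odd odd_one
        rw [if_pos h, if_neg (Int.not_even_iff_odd.2 h'), Int.negOnePow_odd _ h']
        push_cast
        ring
      · have h' : Even (-(i : ℤ) - 1) := h.sub_odd odd_one
        rw [if_neg (Int.not_even_iff_odd.2 h), if_pos h', Int.negOnePow_even _ h', Units.val_one]
        ring

theorem map_shear (u v : Rˣ) (φ : R →+* ℤ) (hu : φ u = -1) (hv : φ v = -1)
    (L : List (ℤˣ × Bool)) : φ (shear u v L) = (drift L).negOnePow * shearCount L := by
  have hu' : φ (u⁻¹ : Rˣ) = -1 := by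
    simpa using map_unit_zpow φ u hu (-1)
  have hv' : φ (v⁻¹ : Rˣ) = -1 := by
    simpa using map_unit_zpow φ v hv (-1)
  induction L using List.reverseRecOn with
  | nil => simp [shearCount]
  | append_singleton L c ih =>
    have hc : shearCount (L ++ [c]) = shearCount L +
        if c.2 then (if c.1 = 1 then (0 : ℤ) else 1) else if c.1 = 1 then -1 else 0 := by
      simp [shearCount]
    have hd := map_unit_zpow φ u hu (-drift L)
    rw [Int.negOnePow_neg] at hd
    simp only [Int.cast_id, zpow_neg] at hd
    rw [shear_concat, hc, drift_concat]
    obtain ⟨ε, b⟩ := c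
    cases b <;> by_cases hε : ε = 1 <;>
      simp [hε, ih, hd, hu', hv, hv', Int.negOnePow_add, Int.negOnePow_neg] <;> ring

/-- With $F$ the dividend of `exists_drift_quotient` and $d$ the drift, the determinant is
$F(d)+(u-1)(v-1)(uv-1)\,\sigma$ if the odd strand leaves at the top and
$F(d+1)-(u-1)(v-1)(uv-1)\,\sigma$ if it leaves at the bottom, where $\sigma$ is the shear. -/
theorem exists_clasp_quotient (u v : Rˣ) (φ : R →+* ℤ) (hu : φ u = -1) (hv : φ v = -1)
    (L : List (ℤˣ × Bool)) (e : Bool) :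
    ∃ q : R, (claspLeftBlock (u : R) v e + claspRightBlock (u : R) e * transfer u v L).det =
        (u - 1) * (v - 1) * (u * v - 1) * q ∧
      2 * φ q = (drift L).negOnePow * (if e then 1 else -1) *
        (2 * shearCount L - drift L - if Even (drift L) then 0 else if e then -1 else 1) := by
  have hs := map_shear u v φ hu hv L
  cases e
  · obtain ⟨q, h1, h2⟩ := exists_drift_quotient u v φ hu hv (drift L + 1)
    refine ⟨q - shear u v L, ?_, ?_⟩
    · have hui : ((u ^ (-drift L) : Rˣ) : R) = u * (u ^ (-(drift L + 1)) : Rˣ) := by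
        rw [← Units.val_mul, ← zpow_one_add]
        congr 2
        ring
      have hvi : ((v ^ (drift L + 1) : Rˣ) : R) = (v ^ drift L : Rˣ) * v := by
        rw [← Units.val_mul, ← zpow_add_one]
      rw [hvi] at h1
      rw [mul_sub, h1]
      simp only [claspLeftBlock, claspRightBlock, transfer, Bool.false_eq_true, if_false]
      generalize ((u ^ (-drift L) : Rˣ) : R) = x at hui ⊢
      generalize ((u ^ (-(drift L + 1)) : Rˣ) : R) = y at hui ⊢
      simp [Matrix.det_fin_two]
      linear_combination (v - 1) * hui
    · rw [map_sub, mul_sub, h2, hs]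
      rcases Int.even_or_odd (drift L) with h | h
      · have h' : ¬ Even (drift L + 1) := by simpa [Int.even_add_one] using h
        simp [h, h', Int.negOnePow_even _ h]
      · have h' : Even (drift L + 1) := h.add_one
        simp [h', Int.not_even_iff_odd.2 h, Int.negOnePow_odd _ h]
        ring
  · obtain ⟨q, h1, h2⟩ := exists_drift_quotient u v φ hu hv (drift L)
    refine ⟨q + shear u v L, ?_, ?_⟩
    · rw [mul_add, h1]
      simp [claspLeftBlock, claspRightBlock, transfer, Matrix.det_fin_two]
      ring
    · rw [map_add, mul_add, h2, hs]
      rcases Int.even_or_odd (drift L) with h | h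
      · simp [h, Int.negOnePow_even _ h]
        ring
      · simp [Int.not_even_iff_odd.2 h, Int.negOnePow_odd _ h]
        ring

/-- The positions cancel: each of the four kinds of crossing contributes minus its sign. -/
theorem two_mul_shearCount_sub_drift (L : List (ℤˣ × Bool)) :
    2 * shearCount L - drift L = -signSum L := by
  induction L with
  | nil => rfl
  | cons c L ih =>
    simp only [shearCount, drift, signSum, List.map_cons, List.sum_cons] at ih ⊢
    obtain ⟨ε, b⟩ := c
    rcases Int.units_eq_one_or ε with rfl | rfl <;> cases b <;> simp <;> linarith

theorem even_drift_iff (L : List (ℤˣ × Bool)) : Even (drift L) ↔ Even L.length := by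
  induction L with
  | nil => simp
  | cons c L ih =>
    simp only [drift, List.map_cons, List.sum_cons, List.length_cons] at ih ⊢
    cases c.2 <;> simp [ih, Int.even_add, Nat.even_add_one]

/-- Only top entries contribute $-1$, and their number is the drift plus the number of bottom
entries. -/
theorem prod_eq_negOnePow (φ : R →+* ℤ) {u v : R} (hu : φ u = -1) (hv : φ v = -1)
    (L : List (ℤˣ × Bool)) :
    φ (L.map fun c => if c.2 then u else -v).prod =
      (drift L).negOnePow * (-1) ^ bottomCount L := by
  induction L with
  | nil => simp [bottomCount]
  | cons c L ih =>
    simp only [drift, bottomCount, List.map_cons, List.sum_cons, List.prod_cons, map_mul,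
      List.countP_cons] at ih ⊢
    rw [ih]
    cases c.2 <;> simp [hu, hv, Int.negOnePow_add, pow_succ]

theorem exists_alexander_quotient (u v : Rˣ) (g : MvPolynomial (Fin 2) ℤ →+* R)
    (hgu : g VirtualTwist.u = u) (hgv : g VirtualTwist.v = v)
    (φ : R →+* ℤ) (hu : φ u = -1) (hv : φ v = -1) (L : List (ℤˣ × Bool)) (e : Bool) :
    ∃ q : R, g (vtLink L e).alexander = (u - 1) * (v - 1) * (u * v - 1) * q ∧
      2 * φ q = (-1) ^ bottomCount L * (if e then -1 else 1) *
        (signSum L + if Even L.length then 0 else if e then -1 else 1) := by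
  obtain ⟨q, h1, h2⟩ := exists_clasp_quotient u v φ hu hv L e
  refine ⟨q * (L.map fun c => if c.2 then (u : R) else -v).prod, ?_, ?_⟩
  · rw [alexanderMatrix_map_det u v g hgu hgv, h1, mul_assoc]
  · have hd : ((drift L).negOnePow : ℤ) * (drift L).negOnePow = 1 := by
      rw [← Units.val_mul, ← Int.negOnePow_add, Int.negOnePow_even _ (Even.add_self _),
        Units.val_one]
    rw [map_mul, ← mul_assoc, h2, prod_eq_negOnePow φ hu hv, two_mul_shearCount_sub_drift]
    simp only [even_drift_iff]
    generalize ((drift L).negOnePow : ℤ) = d at hd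
    cases e
    · simp only [Bool.false_eq_true, if_false]
      linear_combination ((-1) ^ bottomCount L *
        (signSum L + if Even L.length then 0 else 1)) * hd
    · simp only [if_true]
      linear_combination (-(-1) ^ bottomCount L *
        (signSum L + if Even L.length then 0 else -1)) * hd

end Quotient

/-! ### From the localization back to polynomials -/

section Descent

open MvPolynomial

theorem dvd_of_dvd_u_mul_v_pow_mul {f a b : MvPolynomial (Fin 2) ℤ} (n : ℕ)
    (hu : ¬ u ∣ f) (hv : ¬ v ∣ f) (h : a * (u * v) ^ n = f * b) : f ∣ a := by
  have pu : Prime u := MvPolynomial.X_prime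
  have pv : Prime v := MvPolynomial.X_prime
  obtain ⟨b', rfl⟩ := pu.pow_dvd_of_dvd_mul_left n hu
    (Dvd.intro_left (a * v ^ n) (by rw [← h, mul_pow]; ring))
  have h' : a * v ^ n = f * b' := by
    apply mul_left_cancel₀ (pow_ne_zero n pu.ne_zero)
    linear_combination h - a * mul_pow u v n
  obtain ⟨b'', rfl⟩ := pv.pow_dvd_of_dvd_mul_left n hv (Dvd.intro_left a h')
  refine ⟨b'', ?_⟩
  apply mul_left_cancel₀ (pow_ne_zero n pv.ne_zero)
  linear_combination h'

theorem exists_isReducedAlexander_and_eval (L : List (ℤˣ × Bool)) (e : Bool) :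
    ∃ q : MvPolynomial (Fin 2) ℤ, (vtLink L e).IsReducedAlexander q ∧
      2 * eval (fun _ => (-1 : ℤ)) q = (-1) ^ bottomCount L * (if e then -1 else 1) *
        (signSum L + if Even L.length then 0 else if e then -1 else 1) := by
  let S := Localization.Away (u * v)
  let g : MvPolynomial (Fin 2) ℤ →+* S := algebraMap _ S
  have hw : IsUnit (g (u * v)) := IsLocalization.Away.algebraMap_isUnit _
  rw [map_mul] at hw
  obtain ⟨U, hU⟩ := isUnit_of_mul_isUnit_left hw
  obtain ⟨V, hV⟩ := isUnit_of_mul_isUnit_right hw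
  -- Evaluation at $(-1,-1)$ extends to the localization because $uv$ takes the value $1$.
  have heval : IsUnit (eval (fun _ => (-1 : ℤ)) (u * v)) := by simp [u, v]
  let φ : S →+* ℤ := IsLocalization.Away.lift (u * v) heval
  have hφ : ∀ x, φ (g x) = eval (fun _ => (-1 : ℤ)) x := IsLocalization.Away.lift_eq _ heval
  obtain ⟨q, h1, h2⟩ := exists_alexander_quotient U V g hU.symm hV.symm φ
    (by rw [hU, hφ]; simp [u]) (by rw [hV, hφ]; simp [v]) L e
  obtain ⟨n, b, hb⟩ := IsLocalization.Away.surj (u * v) q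
  have hne : (u * v : MvPolynomial (Fin 2) ℤ) ≠ 0 :=
    mul_ne_zero (X_ne_zero _) (X_ne_zero _)
  have hinj : Function.Injective g :=
    IsLocalization.injective S (powers_le_nonZeroDivisors_of_noZeroDivisors hne)
  have hf : g ((u - 1) * (v - 1) * (u * v - 1)) = (U - 1) * (V - 1) * (U * V - 1) := by
    simp [hU, hV]
  have hdvd : (u - 1) * (v - 1) * (u * v - 1) ∣ (vtLink L e).alexander := by
    refine dvd_of_dvd_u_mul_v_pow_mul (b := b) n ?_ ?_ ?_
    -- At $(0,0)$ the divisor is $-1$, whereas a multiple of $u$ vanishes; likewise for $v$.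
    · rintro ⟨x, hx⟩
      have := congrArg (eval (fun _ => (0 : ℤ))) hx
      simp [u, v] at this
    · rintro ⟨x, hx⟩
      have := congrArg (eval (fun _ => (0 : ℤ))) hx
      simp [u, v] at this
    · apply hinj
      rw [map_mul, map_mul, map_pow, hf, ← hb, h1]
      ring
  obtain ⟨r, hr⟩ := hdvd
  refine ⟨r, hr, ?_⟩
  have hf0 : (u - 1) * (v - 1) * (u * v - 1) ≠ (0 : MvPolynomial (Fin 2) ℤ) := by
    intro h
    have := congrArg (eval (fun _ => (0 : ℤ))) h
    simp [u, v] at this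
  have : IsDomain S :=
    IsLocalization.isDomain_localization (powers_le_nonZeroDivisors_of_noZeroDivisors hne)
  have hq : g r = q := by
    refine mul_left_cancel₀ (fun h => hf0 (hinj (h.trans (map_zero g).symm))) ?_
    rw [hf, ← h1, ← hf, ← map_mul, hr]
  rw [← hφ, hq, h2]

theorem LinkDiagram.IsReducedAlexander.unique {N : ℕ} {D : LinkDiagram N}
    {q r : MvPolynomial (Fin 2) ℤ} (hq : D.IsReducedAlexander q) (hr : D.IsReducedAlexander r) :
    q = r := by
  refine mul_left_cancel₀ (fun h => ?_) (hq.symm.trans hr)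
  have := congrArg (eval (fun _ => (0 : ℤ))) h
  simp [u, v] at this

end Descent

/-! ### Odd crossings and the odd writhe -/

section OddWrithe

/-- A two-colouring of the arcs of a knot diagram that changes at each classical crossing decides
which crossings are odd. -/
theorem KnotDiagram.isOdd_iff {N : ℕ} (D : KnotDiagram N) (par : Arc N → ZMod 2)
    (hpar : ∀ x, par (D.next x) = par x + 1) (c : Fin N) :
    D.IsOdd c ↔ par (D.arcIn c .under) = par (D.arcOut c .over) + 1 := by
  classical
  have hiter : ∀ (k : ℕ) x, par (D.next^[k] x) = par x + k := by
    intro k x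
    induction k with
    | zero => simp
    | succ k ih =>
      rw [Function.iterate_succ_apply', hpar, ih]
      push_cast
      ring
  constructor
  · rintro ⟨k, hk, h, -⟩
    rw [← h, hiter, (ZMod.natCast_eq_one_iff_odd).2 hk]
  · intro h
    -- The first passage time has the parity dictated by the colouring.
    have hex := D.connected (D.arcOut c .over) (D.arcIn c .under)
    refine ⟨Nat.find hex, ?_, Nat.find_spec hex, fun j hj => Nat.find_min hex hj⟩
    rw [← Nat.find_spec hex, hiter] at h
    exact (ZMod.natCast_eq_one_iff_odd).1 (add_left_cancel h)

/-- The parity of the position of an arc along a virtual twist knot. -/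
def arcParity {N : ℕ} (x : Arc N) : ZMod 2 := (x.1 : ℕ) + (x.2 : ℕ)

theorem arcParity_next (L : List (ℤˣ × Bool)) (e : Bool) (x : Arc (L.length + 1)) :
    arcParity ((vtLink L e).next x) = arcParity x + 1 := by
  obtain ⟨⟨c, s⟩, rfl⟩ := (vtLink L e).arcIn_bijective.2 x
  rw [LinkDiagram.next_arcIn]
  have h2 : (1 : ZMod 2) + 1 = 0 := rfl
  cases c using Fin.cases with
  | zero =>
    cases s
    · simp [vtLink, vtIn, vtOut, arcParity, h2]
    · simp [vtLink, vtIn, vtOut, arcParity]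
  | succ i =>
    simp only [vtLink, vtIn, vtOut, Fin.cons_succ]
    split_ifs
    · simp [arcParity]
    · simp [arcParity, add_assoc, h2]

/-- At a twist crossing the outgoing over arc and the incoming under arc form one pair, so their
colours differ and the crossing is odd. At the clasp they are the arcs `(0, 0)` and `(Fin.last _,
0)`, whose colours differ exactly when the twist has odd length. -/
theorem oddWrithe_eq (L : List (ℤˣ × Bool)) (e : Bool) (D : KnotDiagram (L.length + 1))
    (hD : D.toLinkDiagram = vtLink L e) :
    D.oddWrithe = signSum L + if Even L.length then 0 else if e then -1 else 1 := by
  have hodd := D.isOdd_iff arcParity (by rw [hD]; exact arcParity_next L e)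
  rw [hD] at hodd
  have h2 : (1 : ZMod 2) + 1 = 0 := rfl
  have htwist : ∀ i : Fin L.length, D.IsOdd i.succ := by
    intro i
    rw [hodd]
    simp only [vtLink, vtIn, vtOut, Fin.cons_succ]
    by_cases h : oddOver (L.get i) = true
    · simp only [h]
      simp [arcParity]
    · simp only [h]
      simp [arcParity, add_assoc, h2]
  have hclasp : D.IsOdd 0 ↔ ¬ Even L.length := by
    rw [hodd, Nat.not_even_iff_odd, ← ZMod.natCast_eq_one_iff_odd]
    simp [vtLink, vtIn, vtOut, arcParity]
  rw [KnotDiagram.oddWrithe, Fin.sum_univ_succ, add_comm]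
  congr 1
  · simp only [htwist, if_true, hD]
    rw [signSum, ← List.sum_ofFn]
    congr 1
    refine List.ext_getElem (by simp) ?_
    simp [vtLink, vtSign]
  · simp only [hclasp, hD]
    by_cases h : Even L.length <;> cases e <;> simp [h, vtLink, vtSign]

end OddWrithe

/-! ### Strand positions along the blocks and the exponent -/

section Blocks

theorem realCrossings_append (b : Bool) (x y : List TwistCrossing) :
    realCrossings b (x ++ y) = realCrossings b x ++ realCrossings (exitPosition b x) y := by
  induction x generalizing b with
  | nil => rfl
  | cons c x ih => cases c <;> simp [realCrossings, exitPosition, ih]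

theorem exitPosition_append (b : Bool) (x y : List TwistCrossing) :
    exitPosition b (x ++ y) = exitPosition (exitPosition b x) y := by
  induction x generalizing b with
  | nil => rfl
  | cons c x ih => simp [exitPosition, ih]

theorem exitPosition_eq (b : Bool) (x : List TwistCrossing) :
    exitPosition b x = (b ^^ decide (Odd x.length)) := by
  induction x generalizing b with
  | nil => simp [exitPosition]
  | cons c x ih =>
    rw [exitPosition, ih]
    by_cases h : Odd x.length <;> simp [h, Nat.odd_add_one]

theorem intercalate_append_eq_flatMap {α : Type*} (w : List α) (l : List (List α)) (hl : l ≠ []) :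
    w.intercalate l ++ w = l.flatMap (· ++ w) := by
  induction l with
  | nil => exact absurd rfl hl
  | cons x l ih =>
    cases l with
    | nil => simp
    | cons y l => rw [List.intercalate_cons_cons, List.append_assoc, ih (by simp)]; simp

/-- The twist, followed by a virtual crossing. -/
def blocksWithVirt {n : ℕ} (a : Fin n → ℤ) : List TwistCrossing :=
  (List.ofFn a).flatMap fun k => block k ++ [.virt]

/-- A final virtual crossing makes all blocks alike, which permits induction on `n`; it leaves the
classical crossings unchanged and flips the exit position. For `n = 0` the two sides differ. -/
theorem twist_append_virt {n : ℕ} (hn : 0 < n) (a : Fin n → ℤ) :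
    twist a ++ [.virt] = blocksWithVirt a := by
  rw [twist, intercalate_append_eq_flatMap _ _ (by simp; omega), blocksWithVirt, List.flatMap_map]

theorem blocksWithVirt_succ {n : ℕ} (a : Fin (n + 1) → ℤ) :
    blocksWithVirt a =
      blocksWithVirt (fun i => a i.castSucc) ++ (block (a (Fin.last n)) ++ [.virt]) := by
  rw [blocksWithVirt, List.ofFn_succ']
  simp [blocksWithVirt]

theorem realCrossings_append_virt (b : Bool) (x : List TwistCrossing) :
    realCrossings b (x ++ [.virt]) = realCrossings b x := by
  simp [realCrossings_append, realCrossings]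

theorem bottomCount_append (L K : List (ℤˣ × Bool)) :
    bottomCount (L ++ K) = bottomCount L + bottomCount K := by
  simp [bottomCount]

/-- Positions alternate within a block, so half of its crossings are entered at the bottom; if their
number is odd, the extra one has the position at the start of the block. -/
theorem bottomCount_block (b : Bool) (k : ℤ) :
    (bottomCount (realCrossings b (block k)) : ℤ) = |k| / 2 + if b then 0 else p k := by
  have key : ∀ (ε : ℤˣ) (m : ℕ) (b : Bool),
      bottomCount (realCrossings b (List.replicate m (.real ε))) =
        m / 2 + if b then 0 else m % 2 := by
    intro ε m
    induction m with
    | zero => intro b; simp [realCrossings, bottomCount]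
    | succ m ih =>
      intro b
      have := ih (!b)
      simp only [bottomCount] at this
      cases b <;> simp [List.replicate_succ, realCrossings, bottomCount] at this ⊢ <;> omega
  rw [block, key]
  have hp : ((k.natAbs % 2 : ℕ) : ℤ) = p k := by
    rw [p]
    split_ifs with h
    · rw [← Int.natAbs_even, Nat.even_iff] at h
      simp [h]
    · rw [← Int.natAbs_even, Nat.not_even_iff] at h
      simp [h]
  cases b
  · push_cast [← hp]
    simp
  · simp

theorem s_castSucc {n : ℕ} (a : Fin (n + 1) → ℤ) {i : ℕ} (hi : i ≤ n) :
    s a i = s (fun j => a j.castSucc) i := by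
  simp [s, Fin.sum_univ_castSucc, hi.not_gt]

theorem s_succ {n : ℕ} (a : Fin (n + 1) → ℤ) :
    s a (n + 1) = s (fun j => a j.castSucc) n + (a (Fin.last n) + 1) := by
  simp [s, Fin.sum_univ_castSucc]

theorem δ_succ {n : ℕ} (a : Fin (n + 1) → ℤ) :
    δ a = δ (fun j => a j.castSucc) + p (a (Fin.last n)) * p (s a (n + 1)) := by
  rw [δ, Fin.sum_univ_castSucc, δ]
  congr 1
  refine Finset.sum_congr rfl fun j _ => ?_
  rw [s_castSucc a (by simp), Fin.val_castSucc]

theorem exitPosition_blocksWithVirt {n : ℕ} (a : Fin n → ℤ) :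
    exitPosition true (blocksWithVirt a) = decide (Even (s a n)) := by
  induction n with
  | zero => simp [blocksWithVirt, exitPosition, s]
  | succ n ih =>
    rw [blocksWithVirt_succ, exitPosition_append, ih, exitPosition_eq, s_succ]
    simp only [block, List.length_append, List.length_replicate, List.length_singleton]
    by_cases h1 : Even (s (fun j => a j.castSucc) n) <;>
      rcases Int.even_or_odd (a (Fin.last n)) with h2 | h2 <;>
      simp [h1, h2, Int.even_add, Nat.odd_add_one, Int.natAbs_odd]

/-- Block $i$ starts at the bottom exactly when $s(i-1)$ is odd. The start matters only for odd
$a_i$, and then $s(i)$ and $s(i-1)$ have the same parity, whence the term $p(a_i)p(s(i))$ of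
$\delta$. -/
theorem bottomCount_blocksWithVirt {n : ℕ} (a : Fin n → ℤ) :
    (bottomCount (realCrossings true (blocksWithVirt a)) : ℤ) = δ a + ∑ i, |a i| / 2 := by
  induction n with
  | zero => simp [blocksWithVirt, realCrossings, bottomCount, δ]
  | succ n ih =>
    rw [blocksWithVirt_succ, realCrossings_append, realCrossings_append_virt, bottomCount_append,
      Nat.cast_add, ih, bottomCount_block, Fin.sum_univ_castSucc, δ_succ, s_succ,
      exitPosition_blocksWithVirt]
    by_cases h1 : Even (s (fun j => a j.castSucc) n) <;>
      rcases Int.even_or_odd (a (Fin.last n)) with h2 | h2 <;>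
      have h3 := Int.not_even_iff_odd (n := a (Fin.last n)) <;>
      simp only [h2, iff_true, not_true, false_iff, Int.not_odd_iff_even] at h3 <;>
      simp [h1, h2, h3, p, Int.even_add] <;> ring

end Blocks

theorem two_mul_eval_eq {n : ℕ} (hn : 0 < n) (a : Fin n → ℤ) :
    (∃ q : MvPolynomial (Fin 2) ℤ, (VT a).IsReducedAlexander q) ∧
    ∀ q : MvPolynomial (Fin 2) ℤ, (VT a).IsReducedAlexander q →
      2 * MvPolynomial.eval (fun _ => (-1 : ℤ)) q =
        ((δ a + s a n + ∑ i : Fin n, |a i| / 2).negOnePow : ℤ) * (VT a).oddWrithe := by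
  obtain ⟨q, hq, h⟩ := exists_isReducedAlexander_and_eval (realCrossings true (twist a))
    (exitPosition true (twist a))
  refine ⟨⟨q, hq⟩, fun r hr => ?_⟩
  have hw := oddWrithe_eq _ _ (VT a) rfl
  rw [hr.unique hq, h]
  refine Eq.trans ?_ (congrArg _ hw.symm)
  congr 1
  have hb := bottomCount_blocksWithVirt a
  have he := exitPosition_blocksWithVirt a
  rw [← twist_append_virt hn, realCrossings_append_virt] at hb
  rw [← twist_append_virt hn, exitPosition_append] at he
  rw [add_right_comm, ← hb, Int.negOnePow_add, Units.val_mul]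
  congr 1
  -- Without the auxiliary last virtual crossing, the odd strand leaves at the top exactly when
  -- $s(n)$ is odd, so the clasp factor is $(-1)^{s(n)}$.
  simp only [exitPosition] at he
  rcases Int.even_or_odd (s a n) with h | h
  · rw [Int.negOnePow_even _ h]
    simp_all
  · rw [Int.negOnePow_odd _ h]
    simp_all [← Int.not_even_iff_odd]

end VirtualTwist

theorem theoremT (n : ℕ) (hn : 0 < n) (a : Fin n → ℤ) :
    (∃ q : MvPolynomial (Fin 2) ℤ, (VirtualTwist.VT a).IsReducedAlexander q) ∧
    ∀ q : MvPolynomial (Fin 2) ℤ, (VirtualTwist.VT a).IsReducedAlexander q →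
      2 * MvPolynomial.eval (fun _ => (-1 : ℤ)) q =
        ((VirtualTwist.δ a + VirtualTwist.s a n + ∑ i : Fin n, |a i| / 2).negOnePow : ℤ) *
          (VirtualTwist.VT a).oddWrithe :=
  VirtualTwist.two_mul_eval_eq hn a
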